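/- **Theorem 4 (Weak soundness).** *Terms and time.* Consider pure $\lambda$-terms (up to renaming of bound variables) with size $|x|=1$, $|\lambda x.t|=|t|+1$, $|tu|=|t|+|u|$. Values are variables and abstractions. Weak call-by-value reduction $\to$ is generated by $(\lambda x.t)v\to t[v/x]$ for $v$ a value, and is closed under $t_1u\to t_2u$ and $ut_1\to ut_2$ whenever $t_1\to t_2$ (no reduction under $\lambda$). A step $t\to u$ costs $\max\{|u|-|t|,1\}$, and costs add up along reduction sequences. $\mathrm{Time}(t)$ is defined iff $t$ reduces to a value, and is then the cost of the evaluation of $t$ to a value. *Types.* Linear formulas $L,M$ and formulas $A,B$ are given by $$L,M::=\alpha\mid\forall\alpha L\mid\mu\alpha L\mid L\multimap M,\qquad A,B::=L\mid\forall\alpha A\mid L\multimap B\mid A\Rightarrow B,$$ where $\mu\alpha L$ is allowed only if $\alpha$ occurs only positively in $L$. A judgment $\Gamma;\Delta\vdash t:A$ has finite contexts $\Gamma$ (assigning formulas to variables) and $\Delta$ (assigning linear formulas to variables), all variables of $\Gamma,\Delta$ being distinct. The rules are as follows, where $L$ always denotes a linear formula: - $x:A;\ \vdash x:A$ and $;x:L\vdash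 x:L$. - From $\Gamma;\Delta\vdash t:\mu\alpha L$ infer $\Gamma;\Delta\vdash t:L[\mu\alpha L/\alpha]$, and conversely. - From $\Gamma;\Delta\vdash t:A$ with $\alpha$ not free in $\Gamma;\Delta$ infer $\Gamma;\Delta\vdash t:\forall\alpha A$. From $\Gamma;\Delta\vdash t:\forall\alpha A$ infer $\Gamma;\Delta\vdash t:A[L/\alpha]$. - From $\Gamma_1;\Delta\vdash t:A\Rightarrow B$ and $\Gamma_2;\ \vdash u:A$ infer $\Gamma_1,\Gamma_2;\Delta\vdash tu:B$. From $\Gamma,z:A;\Delta\vdash t:B$ infer $\Gamma;\Delta\vdash\lambda z.t:A\Rightarrow B$. - From $\Gamma_1;\Delta_1\vdash t:L\multimap B$ and $\Gamma_2;\Delta_2\vdash u:L$ infer $\Gamma_1,\Gamma_2;\Delta_1,\Delta_2\vdash tu:B$. From $\Gamma;\Delta,z:L\vdash t:B$ infer $\Gamma;\Delta\vdash\lambda z.t:L\multimap B$. - Contraction: from $\Gamma,x:A,y:A;\Delta\vdash t:B$ infer $\Gamma,z:A;\Delta\vdash t[z/x,z/y]:B$. - Dereliction: from $\Gamma;\Delta,x:L\vdash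 t:B$ infer $\Gamma,x:L;\Delta\vdash t:B$. - Weakening: from $\Gamma;\Delta\vdash t:B$ infer $\Gamma,\Gamma';\Delta,\Delta'\vdash t:B$. *Church words.* Let $\mathbf W=\forall\alpha\,\big((\alpha\multimap\alpha)\Rightarrow(\alpha\multimap\alpha)\Rightarrow(\alpha\multimap\alpha)\big)$, and for $w=i_1\cdots i_n\in\{0,1\}^*$ let $\mathbf w=\lambda f_0.\lambda f_1.\lambda x.\,f_{i_1}(f_{i_2}(\cdots(f_{i_n}x)\cdots))$. *Statement.* Let $L$ be a linear formula and suppose that $\vdash t:\mathbf W\Rightarrow L$ is derivable (with both contexts empty). Then there is a polynomial $P$ such that for every $w\in\{0,1\}^*$, $\mathrm{Time}(t\,\mathbf w)$ is defined and $\mathrm{Time}(t\,\mathbf w)\le P(|w|)$, where $|w|$ is the length of $w$. -/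

import Mathlib

namespace DIAL

/-! ### Pure lambda terms

Terms up to renaming of bound variables, in locally nameless style: `fvar x` is the variable named
`x`, bound variables are indices `bvar i`. The actual lambda terms are those without dangling
indices; all terms built from `fvar`, `app` and `abs` (see below) are of this kind. -/

inductive Term : Type
  | bvar : ℕ → Term
  | fvar : ℕ → Term
  | lam : Term → Term
  | app : Term → Term → Term

namespace Term

/-- Replace the bound index `k` by `u` (a term without dangling indices). -/
def openAt (u : Term) : ℕ → Term → Term
  | k, bvar i => if i = k then u else bvar i
  | _, fvar x => fvar x
  | k, lam t => lam (openAt u (k + 1) t)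
  | k, app t s => app (openAt u k t) (openAt u k s)

/-- Replace the free variable `x` by the bound index `k`. -/
def closeAt (x : ℕ) : ℕ → Term → Term
  | _, bvar i => bvar i
  | k, fvar y => if y = x then bvar k else fvar y
  | k, lam t => lam (closeAt x (k + 1) t)
  | k, app t s => app (closeAt x k t) (closeAt x k s)

/-- The abstraction `λ x. t` of the named variable `x` in `t`. -/
def abs (x : ℕ) (t : Term) : Term := lam (closeAt x 0 t)

/-- `rename x z t` is `t[z/x]`, for variables `x` and `z`. -/
def rename (x z : ℕ) : Term → Term
  | bvar i => bvar i
  | fvar y => if y = x then fvar z else fvar y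
  | lam t => lam (rename x z t)
  | app t s => app (rename x z t) (rename x z s)

/-- The size: `|x| = 1`, `|λ x. t| = |t| + 1`, `|t u| = |t| + |u|`. -/
def size : Term → ℕ
  | bvar _ => 1
  | fvar _ => 1
  | lam t => size t + 1
  | app t s => size t + size s

/-- Values are variables and abstractions. -/
inductive IsValue : Term → Prop
  | fvar (x : ℕ) : IsValue (fvar x)
  | lam (t : Term) : IsValue (lam t)

/-- One step of weak call-by-value reduction. -/
inductive Step : Term → Term → Prop
  | beta (t v : Term) : IsValue v → Step (app (lam t) v) (openAt v 0 t)
  | appL {t₁ t₂ : Term} (u : Term) : Step t₁ t₂ → Step (app t₁ u) (app t₂ u)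
  | appR {t₁ t₂ : Term} (u : Term) : Step t₁ t₂ → Step (app u t₁) (app u t₂)

/-- `Cost t n u`: the term `t` reduces to `u` with cost `n`. A step from `t` to `u` costs
`max (|u| - |t|) 1` (the truncation of the subtraction is harmless inside the maximum). -/
inductive Cost : Term → ℕ → Term → Prop
  | refl (t : Term) : Cost t 0 t
  | step {t u : Term} : Step t u → Cost t (max (size u - size t) 1) u
  | trans {s t u : Term} {n m : ℕ} : Cost s n t → Cost t m u → Cost s (n + m) u

/-- `HasTime t n`: the term `t` evaluates to a value and `n` is the cost of an evaluation,
that is, `Time(t)` is defined and equal to `n`. -/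
def HasTime (t : Term) (n : ℕ) : Prop := ∃ v, IsValue v ∧ Cost t n v

/-- The body `f_{i₁}(f_{i₂}(…(f_{iₙ} x)…))` for the word `i₁ i₂ … iₙ`
(`false` is the bit 0 and `true` is the bit 1). -/
def churchBody (f₀ f₁ x : Term) : List Bool → Term
  | [] => x
  | b :: w => app (if b then f₁ else f₀) (churchBody f₀ f₁ x w)

/-- The Church word `λ f₀. λ f₁. λ x. f_{i₁}(f_{i₂}(…(f_{iₙ} x)…))`. -/
def churchWord (w : List Bool) : Term :=
  abs 0 (abs 1 (abs 2 (churchBody (fvar 0) (fvar 1) (fvar 2) w)))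

end Term

/-! ### Formulas

Propositional variables are de Bruijn indices. `Formula` is the type of raw expressions;
`IsLinear` and `IsFormula` carve out the linear formulas and the formulas. -/

inductive Formula : Type
  | var : ℕ → Formula
  | all : Formula → Formula
  | mu : Formula → Formula
  | lolli : Formula → Formula → Formula
  | imp : Formula → Formula → Formula

namespace Formula

/-- The extension of a renaming of propositional variables to the scope of one more binder. -/
def upRen (ρ : ℕ → ℕ) : ℕ → ℕ
  | 0 => 0
  | n + 1 => ρ n + 1

/-- Renaming of propositional variables. -/
def ren : (ℕ → ℕ) → Formula → Formula
  | ρ, var n => var (ρ n)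
  | ρ, all A => all (ren (upRen ρ) A)
  | ρ, mu A => mu (ren (upRen ρ) A)
  | ρ, lolli A B => lolli (ren ρ A) (ren ρ B)
  | ρ, imp A B => imp (ren ρ A) (ren ρ B)

/-- Bring a formula into the scope of one new propositional variable (with index `0`). -/
def shift (A : Formula) : Formula := ren Nat.succ A

/-- The extension of a substitution to the scope of one more binder. -/
def upSubst (σ : ℕ → Formula) : ℕ → Formula
  | 0 => var 0
  | n + 1 => shift (σ n)

/-- Simultaneous capture-avoiding substitution for the propositional variables. -/
def subst : (ℕ → Formula) → Formula → Formula
  | σ, var n => σ n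
  | σ, all A => all (subst (upSubst σ) A)
  | σ, mu A => mu (subst (upSubst σ) A)
  | σ, lolli A B => lolli (subst σ A) (subst σ B)
  | σ, imp A B => imp (subst σ A) (subst σ B)

/-- The substitution of `L` for the variable `0`, the other indices being lowered by one. -/
def instSubst (L : Formula) : ℕ → Formula
  | 0 => L
  | n + 1 => var n

/-- `A[L/α]`, where `A` is the body of a binder for `α`. -/
def inst (A L : Formula) : Formula := subst (instSubst L) A

/-- `OccursOnly true n A`: the variable `n` occurs only positively in `A`;
`OccursOnly false n A`: it occurs only negatively. -/
def OccursOnly : Bool → ℕ → Formula → Prop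
  | true, _, var _ => True
  | false, n, var m => m ≠ n
  | b, n, all A => OccursOnly b (n + 1) A
  | b, n, mu A => OccursOnly b (n + 1) A
  | b, n, lolli A B => OccursOnly (!b) n A ∧ OccursOnly b n B
  | b, n, imp A B => OccursOnly (!b) n A ∧ OccursOnly b n B

/-- Linear formulas: `L, M ::= α | ∀ α L | μ α L | L ⊸ M`,
with `α` occurring only positively in the body of `μ α`. -/
inductive IsLinear : Formula → Prop
  | var (n : ℕ) : IsLinear (var n)
  | all {L : Formula} : IsLinear L → IsLinear (all L)
  | mu {L : Formula} : IsLinear L → OccursOnly true 0 L → IsLinear (mu L)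
  | lolli {L M : Formula} : IsLinear L → IsLinear M → IsLinear (lolli L M)

/-- Formulas: `A, B ::= L | ∀ α A | L ⊸ B | A ⇒ B`. -/
inductive IsFormula : Formula → Prop
  | linear {L : Formula} : IsLinear L → IsFormula L
  | all {A : Formula} : IsFormula A → IsFormula (all A)
  | lolli {L B : Formula} : IsLinear L → IsFormula B → IsFormula (lolli L B)
  | imp {A B : Formula} : IsFormula A → IsFormula B → IsFormula (imp A B)

/-- The type of Church words, `∀ α. (α ⊸ α) ⇒ (α ⊸ α) ⇒ (α ⊸ α)`. -/
def churchW : Formula :=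
  all (imp (lolli (var 0) (var 0)) (imp (lolli (var 0) (var 0)) (lolli (var 0) (var 0))))

end Formula

/-! ### Typing -/

/-- Finite collections of assignments `x : A`. -/
abbrev Ctx : Type := Multiset (ℕ × Formula)

namespace Ctx

/-- The variables to which the assignments in `Γ` refer are pairwise distinct. -/
def Distinct (Γ : Ctx) : Prop := (Γ.map Prod.fst).Nodup

/-- Bring all formulas into the scope of one new propositional variable. -/
def shift (Γ : Ctx) : Ctx := Γ.map (fun a => (a.1, a.2.shift))

end Ctx

open Term Formula in
/-- `Typed Γ Δ t A` is the judgment `Γ; Δ ⊢ t : A`. In a judgment, the variables of `Γ` and `Δ`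
together are distinct; this is a side condition wherever a rule could break it. In `allI`, the
side condition that `α` is not free in `Γ; Δ` is expressed by shifting the contexts. -/
inductive Typed : Ctx → Ctx → Term → Formula → Prop
  | ax1 (x : ℕ) {A : Formula} : IsFormula A → Typed {(x, A)} 0 (fvar x) A
  | ax2 (x : ℕ) {L : Formula} : IsLinear L → Typed 0 {(x, L)} (fvar x) L
  | muE {Γ Δ : Ctx} {t : Term} {L : Formula} :
      Typed Γ Δ t (mu L) → Typed Γ Δ t (inst L (mu L))
  | muI {Γ Δ : Ctx} {t : Term} {L : Formula} :
      IsLinear (mu L) → Typed Γ Δ t (inst L (mu L)) → Typed Γ Δ t (mu L)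
  | allI {Γ Δ : Ctx} {t : Term} {A : Formula} :
      Typed Γ.shift Δ.shift t A → Typed Γ Δ t (all A)
  | allE {Γ Δ : Ctx} {t : Term} {A L : Formula} :
      IsLinear L → Typed Γ Δ t (all A) → Typed Γ Δ t (inst A L)
  | impE {Γ₁ Γ₂ Δ : Ctx} {t u : Term} {A B : Formula} :
      Ctx.Distinct (Γ₁ + Γ₂ + Δ) →
      Typed Γ₁ Δ t (imp A B) → Typed Γ₂ 0 u A → Typed (Γ₁ + Γ₂) Δ (app t u) B
  | impI {Γ Δ : Ctx} {z : ℕ} {t : Term} {A B : Formula} :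
      Typed ((z, A) ::ₘ Γ) Δ t B → Typed Γ Δ (Term.abs z t) (imp A B)
  | lolliE {Γ₁ Γ₂ Δ₁ Δ₂ : Ctx} {t u : Term} {L B : Formula} :
      Ctx.Distinct (Γ₁ + Γ₂ + (Δ₁ + Δ₂)) →
      Typed Γ₁ Δ₁ t (lolli L B) → Typed Γ₂ Δ₂ u L →
      Typed (Γ₁ + Γ₂) (Δ₁ + Δ₂) (app t u) B
  | lolliI {Γ Δ : Ctx} {z : ℕ} {t : Term} {L B : Formula} :
      Typed Γ ((z, L) ::ₘ Δ) t B → Typed Γ Δ (Term.abs z t) (lolli L B)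
  | contr {Γ Δ : Ctx} {x y z : ℕ} {t : Term} {A B : Formula} :
      Ctx.Distinct (((z, A) ::ₘ Γ) + Δ) →
      Typed ((x, A) ::ₘ (y, A) ::ₘ Γ) Δ t B →
      Typed ((z, A) ::ₘ Γ) Δ (rename y z (rename x z t)) B
  | derel {Γ Δ : Ctx} {x : ℕ} {t : Term} {L B : Formula} :
      Typed Γ ((x, L) ::ₘ Δ) t B → Typed ((x, L) ::ₘ Γ) Δ t B
  | weak {Γ Γ' Δ Δ' : Ctx} {t : Term} {B : Formula} :
      Ctx.Distinct (Γ + Γ' + (Δ + Δ')) →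
      (∀ a ∈ Γ', IsFormula a.2) → (∀ a ∈ Δ', IsLinear a.2) →
      Typed Γ Δ t B → Typed (Γ + Γ') (Δ + Δ') t B

end DIAL

/-!
A formula denotes a set of values, each with a credit. The credit of a value of type `L ⊸ B` pays,
together with the credit of an argument, for the evaluation of the application and for the credit
of its result. An argument of type `L` is used at most once, so substituting it costs nothing
beyond the credits. An argument of type `A` in `A ⇒ B` may be copied, and every copy costs its
size; a value of type `A ⇒ B` is therefore accompanied by a function that turns bounds for the
size and the credit of an argument into the credit needed for an application. Credits and bounds
for sizes are polynomials in one parameter, which becomes the length of the word in the end: a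
Church word of length `n` copies its arguments at most `n` times, hence its own resources are
polynomials in `n`.
-/

namespace DIAL

namespace Term

/-! ### Costs of evaluations -/

/-- The cost of a single step from `t` to `u`. -/
def weight (t u : Term) : ℕ := max (size u - size t) 1

@[simp]
theorem weight_app_left (t t' u : Term) : weight (app t u) (app t' u) = weight t t' := by
  simp only [weight, size, Nat.add_sub_add_right]

@[simp]
theorem weight_app_right (u t t' : Term) : weight (app u t) (app u t') = weight t t' := by
  simp only [weight, size, Nat.add_sub_add_left]

theorem IsValue.not_step {v u : Term} (hv : IsValue v) : ¬ Step v u := by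
  intro h
  cases hv <;> cases h

theorem Step.diamond {t u u' : Term} (h : Step t u) (h' : Step t u') :
    u = u' ∨ ∃ s, Step u s ∧ Step u' s ∧ weight t u + weight u s = weight t u' + weight u' s := by
  induction h generalizing u' with
  | beta t v hv =>
    cases h' with
    | beta => exact .inl rfl
    | appL _ h' => exact absurd h' (IsValue.lam t).not_step
    | appR _ h' => exact absurd h' hv.not_step
  | @appL t t₁ u h ih =>
    cases h' with
    | beta => exact absurd h (IsValue.lam _).not_step
    | appL _ h' =>
      rcases ih h' with rfl | ⟨s, h₁, h₂, hs⟩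
      · exact .inl rfl
      · exact .inr ⟨app s u, h₁.appL u, h₂.appL u, by simpa using hs⟩
    | @appR _ u₁ _ h' => exact .inr ⟨app t₁ u₁, h'.appR _, h.appL _, by simp [add_comm]⟩
  | @appR t t₁ u h ih =>
    cases h' with
    | beta _ _ hv => exact absurd h hv.not_step
    | appR _ h' =>
      rcases ih h' with rfl | ⟨s, h₁, h₂, hs⟩
      · exact .inl rfl
      · exact .inr ⟨app u s, h₁.appR u, h₂.appR u, by simpa using hs⟩
    | @appL _ u₁ _ h' => exact .inr ⟨app u₁ t₁, h'.appL _, h.appR _, by simp [add_comm]⟩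

/-- Reduction sequences with their costs, in head-first normal form: `Cost` is closed under
arbitrary concatenation, which does not allow an induction on the first step. -/
inductive Steps : Term → ℕ → Term → Prop
  | refl (t : Term) : Steps t 0 t
  | head {t u v : Term} {n : ℕ} : Step t u → Steps u n v → Steps t (weight t u + n) v

theorem Steps.trans {s t u : Term} {n m : ℕ} (h : Steps s n t) (h' : Steps t m u) :
    Steps s (n + m) u := by
  induction h with
  | refl => rwa [zero_add]
  | head h _ ih => rw [add_assoc]; exact .head h (ih h')

theorem Cost.steps {t u : Term} {n : ℕ} (h : Cost t n u) : Steps t n u := by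
  induction h with
  | refl t => exact .refl t
  | step h => exact .head h (.refl _)
  | trans _ _ ih₁ ih₂ => exact ih₁.trans ih₂

theorem Steps.of_step {t u v : Term} {n : ℕ} (h : Steps t n v) (hv : IsValue v) (hu : Step t u) :
    ∃ m, n = weight t u + m ∧ Steps u m v := by
  induction h generalizing u with
  | refl => exact absurd hu hv.not_step
  | @head t u' v n h h' ih =>
    rcases h.diamond hu with rfl | ⟨s, h₁, h₂, hs⟩
    · exact ⟨n, rfl, h'⟩
    · obtain ⟨m, rfl, hm⟩ := ih hv h₁
      exact ⟨weight u s + m, by omega, .head h₂ hm⟩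

theorem Steps.unique {t v v' : Term} {n n' : ℕ} (h : Steps t n v) (hv : IsValue v)
    (h' : Steps t n' v') (hv' : IsValue v') : n = n' ∧ v = v' := by
  induction h generalizing n' with
  | refl =>
    cases h' with
    | refl => exact ⟨rfl, rfl⟩
    | head h _ => exact absurd h hv.not_step
  | head h _ ih =>
    obtain ⟨m, rfl, hm⟩ := h'.of_step hv' h
    obtain ⟨rfl, rfl⟩ := ih hv hm
    exact ⟨rfl, rfl⟩

theorem Cost.unique {t v v' : Term} {n n' : ℕ} (h : Cost t n v) (hv : IsValue v)
    (h' : Cost t n' v') (hv' : IsValue v') : n = n' ∧ v = v' :=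
  h.steps.unique hv h'.steps hv'

theorem HasTime.unique {t : Term} {n n' : ℕ} (h : HasTime t n) (h' : HasTime t n') : n = n' :=
  let ⟨_, hv, hc⟩ := h
  let ⟨_, hv', hc'⟩ := h'
  (hc.unique hv hc' hv').1

theorem Cost.size_le {t u : Term} {n : ℕ} (h : Cost t n u) : size u ≤ size t + n := by
  induction h <;> omega

theorem Cost.appL {t t' : Term} {n : ℕ} (h : Cost t n t') (u : Term) :
    Cost (app t u) n (app t' u) := by
  induction h with
  | refl => exact .refl _
  | step h => simpa only [size, Nat.add_sub_add_right] using Cost.step (h.appL u)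
  | trans _ _ ih₁ ih₂ => exact ih₁.trans ih₂

theorem Cost.appR {t t' : Term} {n : ℕ} (h : Cost t n t') (u : Term) :
    Cost (app u t) n (app u t') := by
  induction h with
  | refl => exact .refl _
  | step h => simpa only [size, Nat.add_sub_add_left] using Cost.step (h.appR u)
  | trans _ _ ih₁ ih₂ => exact ih₁.trans ih₂

/-! ### Substitution of closed terms -/

/-- Local closure: the dangling indices of the term are less than `k`. -/
def LC : ℕ → Term → Prop
  | k, bvar i => i < k
  | _, fvar _ => True
  | k, lam t => LC (k + 1) t
  | k, app t s => LC k t ∧ LC k s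

/-- Simultaneous substitution for the free variables. The indices of the substituted terms are not
lifted under `lam`, so this is the capture-avoiding substitution only when those terms are locally
closed. -/
def bind (σ : ℕ → Term) : Term → Term
  | bvar i => bvar i
  | fvar x => σ x
  | lam t => lam (bind σ t)
  | app t s => app (bind σ t) (bind σ s)

/-- The number of occurrences of the free variable `x`. -/
def occ (x : ℕ) : Term → ℕ
  | bvar _ => 0
  | fvar y => if y = x then 1 else 0
  | lam t => occ x t
  | app t s => occ x t + occ x s

theorem LC.mono {t : Term} {k l : ℕ} (h : LC k t) (hkl : k ≤ l) : LC l t := by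
  induction t generalizing k l with
  | bvar i => exact lt_of_lt_of_le h hkl
  | fvar x => trivial
  | lam t ih => exact ih h (Nat.succ_le_succ hkl)
  | app t s iht ihs => exact ⟨iht h.1 hkl, ihs h.2 hkl⟩

theorem LC.closeAt {t : Term} {k : ℕ} (x : ℕ) (h : LC k t) : LC (k + 1) (closeAt x k t) := by
  induction t generalizing k with
  | bvar i => exact Nat.lt_succ_of_lt h
  | fvar y =>
    by_cases hy : y = x
    · simp only [Term.closeAt, if_pos hy, LC, Nat.lt_succ_self]
    · simp only [Term.closeAt, if_neg hy, LC]
  | lam t ih => exact ih h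
  | app t s iht ihs => exact ⟨iht h.1, ihs h.2⟩

theorem LC.bind {t : Term} {k : ℕ} {σ : ℕ → Term} (h : LC k t) (hσ : ∀ x, LC 0 (σ x)) :
    LC k (bind σ t) := by
  induction t generalizing k with
  | bvar i => exact h
  | fvar y => exact (hσ y).mono (Nat.zero_le k)
  | lam t ih => exact ih h
  | app t s iht ihs => exact ⟨iht h.1, ihs h.2⟩

theorem LC.openAt_eq {t : Term} {k : ℕ} (u : Term) (h : LC k t) : openAt u k t = t := by
  induction t generalizing k with
  | bvar i => exact if_neg (ne_of_lt h)
  | fvar y => rfl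
  | lam t ih => exact congrArg lam (ih h)
  | app t s iht ihs => exact congrArg₂ app (iht h.1) (ihs h.2)

theorem lc_update {σ : ℕ → Term} (hσ : ∀ x, LC 0 (σ x)) (z : ℕ) {u : Term} (hu : LC 0 u) (x : ℕ) :
    LC 0 (Function.update σ z u x) := by
  rcases eq_or_ne x z with rfl | hx
  · rwa [Function.update_self]
  · rw [Function.update_of_ne hx]
    exact hσ x

theorem bind_fvar (t : Term) : bind fvar t = t := by
  induction t with
  | bvar i => rfl
  | fvar y => rfl
  | lam t ih => exact congrArg lam ih
  | app t s iht ihs => exact congrArg₂ app iht ihs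

theorem bind_bind (σ τ : ℕ → Term) (t : Term) : bind σ (bind τ t) = bind (bind σ ∘ τ) t := by
  induction t with
  | bvar i => rfl
  | fvar y => rfl
  | lam t ih => exact congrArg lam ih
  | app t s iht ihs => exact congrArg₂ app iht ihs

theorem rename_eq_bind (x z : ℕ) (t : Term) :
    rename x z t = bind (fvar ∘ Function.update id x z) t := by
  induction t with
  | bvar i => rfl
  | fvar y => by_cases hy : y = x <;> simp [rename, bind, hy]
  | lam t ih => exact congrArg lam ih
  | app t s iht ihs => exact congrArg₂ app iht ihs

theorem bind_rename (σ : ℕ → Term) (x z : ℕ) (t : Term) :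
    bind σ (rename x z t) = bind (σ ∘ Function.update id x z) t := by
  rw [rename_eq_bind, bind_bind]
  rfl

theorem LC.rename {t : Term} {k : ℕ} (x z : ℕ) (h : LC k t) : LC k (rename x z t) := by
  rw [rename_eq_bind]
  exact h.bind fun _ => trivial

theorem openAt_bind_closeAt {t : Term} {k : ℕ} {σ : ℕ → Term} (u : Term) (z : ℕ) (h : LC k t)
    (hσ : ∀ x, LC 0 (σ x)) :
    openAt u k (bind σ (closeAt z k t)) = bind (Function.update σ z u) t := by
  induction t generalizing k with
  | bvar i => exact if_neg (ne_of_lt h)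
  | fvar y =>
    rcases eq_or_ne y z with rfl | hy
    · simp only [closeAt, if_true, bind, openAt, Function.update_self]
    · simp only [closeAt, if_neg hy, bind, Function.update_of_ne hy]
      exact ((hσ y).mono (Nat.zero_le k)).openAt_eq u
  | lam t ih => exact congrArg lam (ih h)
  | app t s iht ihs => exact congrArg₂ app (iht h.1) (ihs h.2)

theorem occ_closeAt (x z k : ℕ) (t : Term) :
    occ x (closeAt z k t) = if x = z then 0 else occ x t := by
  induction t generalizing k with
  | bvar i => simp [closeAt, occ]
  | fvar y => grind [closeAt, occ]
  | lam _ ih => exact ih (k + 1)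
  | app t s iht ihs => simp only [closeAt, occ, iht, ihs]; split_ifs <;> rfl

theorem occ_abs (x z : ℕ) (t : Term) : occ x (abs z t) = if x = z then 0 else occ x t :=
  occ_closeAt x z 0 t

theorem occ_rename_of_ne {w z : ℕ} (hz : w ≠ z) (x : ℕ) (t : Term) :
    occ w (rename x z t) = if w = x then 0 else occ w t := by
  induction t with
  | bvar i => simp [rename, occ]
  | fvar y => grind [rename, occ]
  | lam _ ih => exact ih
  | app t s iht ihs => simp only [rename, occ, iht, ihs]; split_ifs <;> rfl

theorem occ_le_size (x : ℕ) (t : Term) : occ x t ≤ size t := by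
  induction t with
  | bvar i => exact Nat.zero_le _
  | fvar y => simp only [occ, size]; split_ifs <;> omega
  | lam t ih => exact Nat.le_succ_of_le ih
  | app t s iht ihs => exact add_le_add iht ihs

theorem size_bind_closeAt (σ : ℕ → Term) (z k : ℕ) (u t : Term) :
    size (bind (Function.update σ z u) t) + occ z t =
      size (bind σ (closeAt z k t)) + occ z t * size u := by
  induction t generalizing k with
  | bvar i => simp [bind, closeAt, occ, size]
  | fvar y => by_cases hy : y = z <;> simp [bind, closeAt, occ, size, hy, add_comm]
  | lam t ih => have := ih (k + 1); simp only [bind, closeAt, occ, size]; omega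
  | app t s iht ihs =>
    have := iht k
    have := ihs k
    simp only [bind, closeAt, occ, size, add_mul]
    omega

theorem size_bind_le {σ : ℕ → Term} {K : ℕ} {t : Term}
    (h : ∀ x, occ x t ≠ 0 → size (σ x) ≤ K) : size (bind σ t) ≤ size t * (1 + K) := by
  induction t with
  | bvar i => simp [bind, size]
  | fvar y => simpa [bind, size] using Nat.le_add_left_of_le (h y (by simp [occ]))
  | lam t ih => have := ih h; simp only [bind, size, add_mul]; omega
  | app t s iht ihs =>
    have := iht fun x hx => h x (by simp only [occ]; omega)
    have := ihs fun x hx => h x (by simp only [occ]; omega)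
    simp only [bind, size, add_mul]
    omega

theorem cost_app_bind_abs {t u : Term} {σ : ℕ → Term} (z : ℕ) (ht : LC 0 t)
    (hσ : ∀ x, LC 0 (σ x)) (hu : IsValue u) :
    ∃ m ≤ max ((occ z t - 1) * size u) 1,
      Cost (app (bind σ (abs z t)) u) m (bind (Function.update σ z u) t) := by
  have hβ := Cost.step (Step.beta (bind σ (closeAt z 0 t)) u hu)
  rw [openAt_bind_closeAt u z ht hσ] at hβ
  refine ⟨_, max_le_max_right 1 ?_, hβ⟩
  have hsize := size_bind_closeAt σ z 0 u t
  simp only [size, Nat.sub_mul]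
  omega

end Term

namespace Formula

/-! ### Linear formulas under renaming and substitution -/

variable {A B L : Formula} {b : Bool} {n : ℕ} {ρ : ℕ → ℕ} {σ : ℕ → Formula}

theorem isLinear_all : IsLinear (all A) ↔ IsLinear A :=
  ⟨fun | .all h => h, .all⟩

theorem isLinear_mu : IsLinear (mu A) ↔ IsLinear A ∧ OccursOnly true 0 A :=
  ⟨fun | .mu h hpos => ⟨h, hpos⟩, fun h => .mu h.1 h.2⟩

theorem isLinear_lolli : IsLinear (lolli A B) ↔ IsLinear A ∧ IsLinear B :=
  ⟨fun | .lolli hA hB => ⟨hA, hB⟩, fun h => .lolli h.1 h.2⟩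

theorem not_isLinear_imp : ¬ IsLinear (imp A B) := nofun

theorem isFormula_all : IsFormula (all A) ↔ IsFormula A :=
  ⟨fun | .all h => h | .linear (.all h) => .linear h, .all⟩

theorem isFormula_mu : IsFormula (mu A) ↔ IsLinear (mu A) :=
  ⟨fun | .linear h => h, .linear⟩

theorem isFormula_lolli : IsFormula (lolli A B) ↔ IsLinear A ∧ IsFormula B :=
  ⟨fun | .lolli hA hB => ⟨hA, hB⟩ | .linear (.lolli hA hB) => ⟨hA, .linear hB⟩,
    fun h => .lolli h.1 h.2⟩

theorem isFormula_imp : IsFormula (imp A B) ↔ IsFormula A ∧ IsFormula B :=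
  ⟨fun | .imp hA hB => ⟨hA, hB⟩, fun h => .imp h.1 h.2⟩

theorem upRen_injective (h : Function.Injective ρ) : Function.Injective (upRen ρ) := by
  rintro (_ | m) (_ | n) hmn
  · rfl
  · cases hmn
  · cases hmn
  · exact congrArg Nat.succ (h (Nat.succ.inj hmn))

theorem occursOnly_ren (h : Function.Injective ρ) (A : Formula) (b : Bool) (n : ℕ) :
    OccursOnly b (ρ n) (ren ρ A) ↔ OccursOnly b n A := by
  induction A generalizing b n ρ with
  | var m => cases b <;> simp only [ren, OccursOnly, ne_eq, h.eq_iff]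
  | all A ih => simpa only [ren, OccursOnly, upRen] using ih (upRen_injective h) b (n + 1)
  | mu A ih => simpa only [ren, OccursOnly, upRen] using ih (upRen_injective h) b (n + 1)
  | lolli A B ihA ihB => simp only [ren, OccursOnly, ihA h, ihB h]
  | imp A B ihA ihB => simp only [ren, OccursOnly, ihA h, ihB h]

theorem isLinear_ren (h : Function.Injective ρ) (A : Formula) :
    IsLinear (ren ρ A) ↔ IsLinear A := by
  induction A generalizing ρ with
  | var m => exact iff_of_true (.var _) (.var _)
  | all A ih => simp only [ren, isLinear_all, ih (upRen_injective h)]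
  | mu A ih =>
    have hpos := occursOnly_ren (upRen_injective h) A true 0
    simp only [ren, isLinear_mu, ih (upRen_injective h), ← hpos, upRen]
  | lolli A B ihA ihB => simp only [ren, isLinear_lolli, ihA h, ihB h]
  | imp A B => exact iff_of_false not_isLinear_imp not_isLinear_imp

theorem isFormula_ren (h : Function.Injective ρ) (A : Formula) :
    IsFormula (ren ρ A) ↔ IsFormula A := by
  induction A generalizing ρ with
  | var m => exact iff_of_true (.linear (.var _)) (.linear (.var _))
  | all A ih => simp only [ren, isFormula_all, ih (upRen_injective h)]
  | mu A => exact isFormula_mu.trans ((isLinear_ren h (mu A)).trans isFormula_mu.symm)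
  | lolli A B _ ihB => simp only [ren, isFormula_lolli, isLinear_ren h, ihB h]
  | imp A B ihA ihB => simp only [ren, isFormula_imp, ihA h, ihB h]

theorem isLinear_shift : IsLinear A.shift ↔ IsLinear A :=
  isLinear_ren Nat.succ_injective A

theorem isFormula_shift : IsFormula A.shift ↔ IsFormula A :=
  isFormula_ren Nat.succ_injective A

theorem succ_notMem_range_upRen (h : n ∉ Set.range ρ) : n + 1 ∉ Set.range (upRen ρ) := by
  rintro ⟨_ | m, hm⟩
  · cases hm
  · exact h ⟨m, Nat.succ.inj hm⟩

theorem occursOnly_ren_of_notMem_range (h : n ∉ Set.range ρ) (A : Formula) (b : Bool) :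
    OccursOnly b n (ren ρ A) := by
  induction A generalizing b n ρ with
  | var m =>
    cases b
    · exact fun hm => h ⟨m, hm⟩
    · trivial
  | all A ih => simpa only [ren, OccursOnly] using ih (succ_notMem_range_upRen h) b
  | mu A ih => simpa only [ren, OccursOnly] using ih (succ_notMem_range_upRen h) b
  | lolli A B ihA ihB => simpa only [ren, OccursOnly] using ⟨ihA h (!b), ihB h b⟩
  | imp A B ihA ihB => simpa only [ren, OccursOnly] using ⟨ihA h (!b), ihB h b⟩

/-- The substitution fixes the variable `n` and introduces it nowhere else: a formula without `n`
is one in which `n` occurs both only positively and only negatively. -/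
def Fixes (σ : ℕ → Formula) (n : ℕ) : Prop :=
  σ n = var n ∧ ∀ m, m ≠ n → ∀ b, OccursOnly b n (σ m)

theorem Fixes.upSubst (h : Fixes σ n) : Fixes (upSubst σ) (n + 1) := by
  refine ⟨congrArg shift h.1, ?_⟩
  rintro (_ | m) hm b
  · cases b
    · exact Nat.zero_ne_add_one n
    · trivial
  · exact (occursOnly_ren Nat.succ_injective (σ m) b n).2 (h.2 m (by omega) b)

theorem fixes_upSubst_zero (σ : ℕ → Formula) : Fixes (upSubst σ) 0 := by
  refine ⟨rfl, ?_⟩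
  rintro (_ | m) hm b
  · exact absurd rfl hm
  · exact occursOnly_ren_of_notMem_range (fun ⟨k, hk⟩ => Nat.succ_ne_zero k hk) _ b

theorem OccursOnly.subst (h : OccursOnly b n A) (hσ : Fixes σ n) : OccursOnly b n (subst σ A) := by
  induction A generalizing b n σ with
  | var m =>
    rcases eq_or_ne m n with rfl | hm
    · rwa [Formula.subst, hσ.1]
    · exact hσ.2 m hm b
  | all A ih =>
    simp only [Formula.subst, OccursOnly] at h ⊢
    exact ih h hσ.upSubst
  | mu A ih =>
    simp only [Formula.subst, OccursOnly] at h ⊢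
    exact ih h hσ.upSubst
  | lolli A B ihA ihB =>
    simp only [Formula.subst, OccursOnly] at h ⊢
    exact ⟨ihA h.1 hσ, ihB h.2 hσ⟩
  | imp A B ihA ihB =>
    simp only [Formula.subst, OccursOnly] at h ⊢
    exact ⟨ihA h.1 hσ, ihB h.2 hσ⟩

theorem isLinear_upSubst (h : ∀ n, IsLinear (σ n)) : ∀ n, IsLinear (upSubst σ n)
  | 0 => .var 0
  | n + 1 => isLinear_shift.2 (h n)

theorem isLinear_instSubst (h : IsLinear L) : ∀ n, IsLinear (instSubst L n)
  | 0 => h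
  | n + 1 => .var n

theorem IsLinear.subst (hA : IsLinear A) (h : ∀ n, IsLinear (σ n)) : IsLinear (subst σ A) := by
  induction hA generalizing σ with
  | var n => exact h n
  | all _ ih => exact .all (ih (isLinear_upSubst h))
  | mu _ hpos ih => exact .mu (ih (isLinear_upSubst h)) (hpos.subst (fixes_upSubst_zero σ))
  | lolli _ _ ihA ihB => exact .lolli (ihA h) (ihB h)

theorem IsFormula.subst (hA : IsFormula A) (h : ∀ n, IsLinear (σ n)) : IsFormula (subst σ A) := by
  induction hA generalizing σ with
  | linear hL => exact .linear (hL.subst h)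
  | all _ ih => exact .all (ih (isLinear_upSubst h))
  | lolli hL _ ih => exact .lolli (hL.subst h) (ih h)
  | imp _ _ ihA ihB => exact .imp (ihA h) (ihB h)

end Formula

/-! ### Well-formedness of derivable judgments -/

namespace Ctx

/-- The variables declared in a context, with multiplicities. -/
def dom (Γ : Ctx) : Multiset ℕ := Γ.map Prod.fst

@[simp]
theorem dom_zero : dom 0 = 0 := rfl

@[simp]
theorem dom_singleton (a : ℕ × Formula) : dom {a} = {a.1} := rfl

@[simp]
theorem dom_cons (a : ℕ × Formula) (Γ : Ctx) : dom (a ::ₘ Γ) = a.1 ::ₘ dom Γ :=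
  Multiset.map_cons _ _ _

@[simp]
theorem dom_add (Γ Δ : Ctx) : dom (Γ + Δ) = dom Γ + dom Δ :=
  Multiset.map_add _ _ _

@[simp]
theorem dom_shift (Γ : Ctx) : dom Γ.shift = dom Γ :=
  Multiset.map_map _ _ _

theorem mem_dom_of_mem {Γ : Ctx} {a : ℕ × Formula} (h : a ∈ Γ) : a.1 ∈ dom Γ :=
  Multiset.mem_map_of_mem _ h

theorem distinct_iff {Γ : Ctx} : Γ.Distinct ↔ Γ.dom.Nodup := Iff.rfl

theorem forall_mem_shift {Γ : Ctx} {p : ℕ × Formula → Prop} :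
    (∀ a ∈ Γ.shift, p a) ↔ ∀ a ∈ Γ, p (a.1, a.2.shift) :=
  Multiset.forall_mem_map_iff

end Ctx

section

open Formula

variable {Γ Δ : Ctx} {t : Term} {A : Formula}

theorem Typed.nodup_dom (h : Typed Γ Δ t A) : (Γ.dom + Δ.dom).Nodup := by
  rw [← Ctx.dom_add, ← Ctx.distinct_iff]
  induction h with
  | ax1 | ax2 => exact Multiset.nodup_singleton _
  | muE _ ih | muI _ _ ih | allE _ _ ih => exact ih
  | allI _ ih => simpa only [Ctx.distinct_iff, Ctx.dom_add, Ctx.dom_shift] using ih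
  | impE h | lolliE h | contr h | weak h => exact h
  | impI _ ih =>
    rw [Multiset.cons_add, Ctx.distinct_iff, Ctx.dom_cons] at ih
    exact (Multiset.nodup_cons.1 ih).2
  | lolliI _ ih =>
    rw [Multiset.add_cons, Ctx.distinct_iff, Ctx.dom_cons] at ih
    exact (Multiset.nodup_cons.1 ih).2
  | derel _ ih => rwa [Multiset.cons_add, ← Multiset.add_cons]

theorem Typed.notMem_of_cons_left {z : ℕ} {B : Formula} (h : Typed ((z, B) ::ₘ Γ) Δ t A) :
    z ∉ Γ.dom + Δ.dom := by
  have hnodup := h.nodup_dom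
  rw [Ctx.dom_cons, Multiset.cons_add] at hnodup
  exact (Multiset.nodup_cons.1 hnodup).1

theorem Typed.notMem_of_cons_right {z : ℕ} {B : Formula} (h : Typed Γ ((z, B) ::ₘ Δ) t A) :
    z ∉ Γ.dom + Δ.dom := by
  have hnodup := h.nodup_dom
  rw [Ctx.dom_cons, Multiset.add_cons] at hnodup
  exact (Multiset.nodup_cons.1 hnodup).1

theorem Typed.lc (h : Typed Γ Δ t A) : t.LC 0 := by
  induction h with
  | ax1 | ax2 => trivial
  | muE _ ih | muI _ _ ih | allI _ ih | allE _ _ ih | derel _ ih | weak _ _ _ _ ih => exact ih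
  | impE _ _ _ iht ihu | lolliE _ _ _ iht ihu => exact ⟨iht, ihu⟩
  | impI _ ih | lolliI _ ih => exact ih.closeAt _
  | contr _ _ ih => exact (ih.rename _ _).rename _ _

theorem Typed.isFormula_and_forall_mem (h : Typed Γ Δ t A) :
    IsFormula A ∧ (∀ a ∈ Γ, IsFormula a.2) ∧ ∀ a ∈ Δ, IsLinear a.2 := by
  induction h with
  | ax1 x hA => simp [hA]
  | ax2 x hL => simp [hL, IsFormula.linear hL]
  | muE _ ih =>
    have hL := isFormula_mu.1 ih.1
    exact ⟨.linear ((isLinear_mu.1 hL).1.subst (isLinear_instSubst hL)), ih.2⟩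
  | muI hL _ ih => exact ⟨.linear hL, ih.2⟩
  | allI _ ih =>
    simp only [Ctx.forall_mem_shift, isFormula_shift, isLinear_shift] at ih
    exact ⟨.all ih.1, ih.2⟩
  | allE hL _ ih => exact ⟨(isFormula_all.1 ih.1).subst (isLinear_instSubst hL), ih.2⟩
  | impE _ _ _ iht ihu => grind [isFormula_imp]
  | lolliE _ _ _ iht ihu => grind [isFormula_lolli]
  | impI _ ih =>
    simp only [Multiset.forall_mem_cons] at ih
    exact ⟨.imp ih.2.1.1 ih.1, ih.2.1.2, ih.2.2⟩
  | lolliI _ ih =>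
    simp only [Multiset.forall_mem_cons] at ih
    exact ⟨.lolli ih.2.2.1 ih.1, ih.2.1, ih.2.2.2⟩
  | contr _ _ ih =>
    simp only [Multiset.forall_mem_cons] at ih ⊢
    exact ⟨ih.1, ih.2.1.2, ih.2.2⟩
  | derel _ ih =>
    simp only [Multiset.forall_mem_cons] at ih ⊢
    exact ⟨ih.1, ⟨.linear ih.2.2.1, ih.2.1⟩, ih.2.2.2⟩
  | weak _ hΓ' hΔ' _ ih => grind

theorem Typed.isFormula (h : Typed Γ Δ t A) : IsFormula A :=
  h.isFormula_and_forall_mem.1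

theorem Typed.isLinear_of_mem (h : Typed Γ Δ t A) {a : ℕ × Formula} (ha : a ∈ Δ) : IsLinear a.2 :=
  h.isFormula_and_forall_mem.2.2 a ha

theorem Typed.occ_le_count (h : Typed Γ Δ t A) {x : ℕ} (hx : x ∉ Γ.dom) :
    t.occ x ≤ Δ.dom.count x := by
  induction h with
  | ax1 y =>
    have hy : y ≠ x := by simpa [eq_comm] using hx
    simp [Term.occ, hy]
  | ax2 y => simp [Term.occ, Multiset.count_singleton, eq_comm]
  | muE _ ih | muI _ _ ih | allE _ _ ih => exact ih hx
  | allI _ ih => simpa only [Ctx.dom_shift] using ih (by rwa [Ctx.dom_shift])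
  | impE _ _ _ iht ihu =>
    simp only [Ctx.dom_add, Multiset.mem_add, not_or] at hx
    simpa [Term.occ] using add_le_add (iht hx.1) (ihu hx.2)
  | lolliE _ _ _ iht ihu =>
    simp only [Ctx.dom_add, Multiset.mem_add, not_or] at hx
    simpa [Term.occ] using add_le_add (iht hx.1) (ihu hx.2)
  | @impI _ _ z _ _ _ _ ih =>
    rw [Term.occ_abs]
    split_ifs with hz
    · exact Nat.zero_le _
    · exact ih (by simp [hz, hx])
  | @lolliI _ _ z _ _ _ _ ih =>
    rw [Term.occ_abs]
    split_ifs with hz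
    · exact Nat.zero_le _
    · simpa [hz] using ih hx
  | @contr _ _ y₁ y₂ z _ _ _ _ _ ih =>
    simp only [Ctx.dom_cons, Multiset.mem_cons, not_or] at hx
    rw [Term.occ_rename_of_ne hx.1, Term.occ_rename_of_ne hx.1]
    split_ifs with h₂ h₁
    · exact Nat.zero_le _
    · exact Nat.zero_le _
    · exact ih (by simp [h₁, h₂, hx.2])
  | derel _ ih =>
    simp only [Ctx.dom_cons, Multiset.mem_cons, not_or] at hx
    simpa [hx.1] using ih hx.2
  | weak _ _ _ _ ih =>
    simp only [Ctx.dom_add, Multiset.mem_add, not_or] at hx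
    exact (ih hx.1).trans (Multiset.count_le_of_le x (by simp))

theorem Typed.occ_eq_zero (h : Typed Γ Δ t A) {x : ℕ} (hx : x ∉ Γ.dom + Δ.dom) : t.occ x = 0 := by
  rw [Multiset.mem_add, not_or] at hx
  simpa [Multiset.count_eq_zero_of_notMem hx.2] using h.occ_le_count hx.1

theorem Typed.occ_le_one (h : Typed Γ Δ t A) {x : ℕ} (hx : x ∈ Δ.dom) : t.occ x ≤ 1 := by
  obtain ⟨-, hΔ, hΓΔ⟩ := Multiset.nodup_add.1 h.nodup_dom
  have hxΓ : x ∉ Γ.dom := fun hxΓ => Multiset.disjoint_left.1 hΓΔ hxΓ hx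
  exact (h.occ_le_count hxΓ).trans (Multiset.nodup_iff_count_le_one.1 hΔ x)

end

open Term Formula
open scoped Polynomial

/-! ### Resources -/

/-- What a realizer comes with: a credit, given as a polynomial in one parameter, and a resource. -/
structure Grade (R : Type) where
  credit : ℕ[X]
  res : R

/-- What is known about an argument that can be duplicated: the grade of one copy and a bound for
the size, which is the price of a further copy. -/
structure Bound (R : Type) extends Grade R where
  size : ℕ[X]

/-- The shape of a formula, that is, its nesting of intuitionistic implications. -/
inductive Shape : Type
  | base : Shape
  | arr : Shape → Shape → Shape
  deriving DecidableEq

/-- The resources of a given shape: a realizer of `A ⇒ B` comes with a function that turns bounds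
for its argument into a grade for the result. -/
def Shape.Res : Shape → Type
  | base => Unit
  | arr s t => Bound s.Res → Grade t.Res

/-- The only resource of shape `base`. -/
def Shape.Res.unit : Res base := ()

instance Shape.Res.instNonempty : (s : Shape) → Nonempty s.Res
  | base => ⟨.unit⟩
  | arr _ t => let ⟨r⟩ := instNonempty t; ⟨fun _ => ⟨0, r⟩⟩

namespace Formula

/-- The shape of a formula. Linear formulas have shape `base`. -/
def shape : Formula → Shape
  | var _ => .base
  | all A => shape A
  | mu _ => .base
  | lolli _ B => shape B
  | imp A B => .arr (shape A) (shape B)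

theorem shape_ren (ρ : ℕ → ℕ) (A : Formula) : shape (ren ρ A) = shape A := by
  induction A generalizing ρ <;> simp_all only [ren, shape]

theorem shape_shift (A : Formula) : shape A.shift = shape A :=
  shape_ren _ A

theorem shape_upSubst {σ : ℕ → Formula} (h : ∀ n, shape (σ n) = .base) :
    ∀ n, shape (upSubst σ n) = .base
  | 0 => rfl
  | n + 1 => (shape_shift _).trans (h n)

theorem shape_subst {σ : ℕ → Formula} (h : ∀ n, shape (σ n) = .base) (A : Formula) :
    shape (subst σ A) = shape A := by
  induction A generalizing σ with
  | var n => exact h n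
  | all _ ih => exact ih (shape_upSubst h)
  | mu A => rfl
  | lolli _ _ _ ihB => exact ihB h
  | imp A B ihA ihB => exact congrArg₂ Shape.arr (ihA h) (ihB h)

theorem IsLinear.shape {L : Formula} (h : IsLinear L) : L.shape = .base := by
  induction h <;> simp_all only [Formula.shape]

theorem shape_inst {L : Formula} (h : IsLinear L) (A : Formula) : shape (inst A L) = shape A :=
  shape_subst (fun n => (isLinear_instSubst h n).shape) A

end Formula

/-! ### Candidates -/

/-- Reducibility candidates: sets of locally closed values with a credit, closed under raising the
credit. -/
structure Cand where
  carrier : Set (Term × ℕ)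
  isValue' {a : Term × ℕ} : a ∈ carrier → IsValue a.1
  lc' {a : Term × ℕ} : a ∈ carrier → LC 0 a.1
  mono' {v : Term} {c d : ℕ} : (v, c) ∈ carrier → c ≤ d → (v, d) ∈ carrier

namespace Cand

instance : SetLike Cand (Term × ℕ) where
  coe := carrier
  coe_injective X Y h := by cases X; cases Y; congr

instance : PartialOrder Cand := .ofSetLike Cand (Term × ℕ)

variable {X : Cand} {c d : ℕ} {v : Term}

theorem isValue (h : (v, c) ∈ X) : IsValue v := X.isValue' h

theorem lc (h : (v, c) ∈ X) : LC 0 v := X.lc' h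

theorem mono (h : (v, c) ∈ X) (hcd : c ≤ d) : (v, d) ∈ X := X.mono' h hcd

instance : InfSet Cand where
  sInf S :=
    { carrier := {a | IsValue a.1 ∧ LC 0 a.1 ∧ ∀ X ∈ S, a ∈ X}
      isValue' h := h.1
      lc' h := h.2.1
      mono' h hcd := ⟨h.1, h.2.1, fun X hX => X.mono' (h.2.2 X hX) hcd⟩ }

instance : CompleteLattice Cand :=
  completeLatticeOfInf Cand fun _ =>
    ⟨fun X hX _ ha => ha.2.2 X hX,
      fun _ hY _ ha => ⟨Cand.isValue' _ ha, Cand.lc' _ ha, fun _ hX => hY hX ha⟩⟩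

theorem mem_iInf {ι : Type} [Nonempty ι] {F : ι → Cand} {a : Term × ℕ} :
    a ∈ ⨅ i, F i ↔ ∀ i, a ∈ F i := by
  refine ⟨fun h i => iInf_le F i h, fun h => ?_⟩
  obtain ⟨i⟩ := ‹Nonempty ι›
  exact ⟨(F i).isValue' (h i), (F i).lc' (h i), Set.forall_mem_range.2 h⟩

end Cand

/-- The term `t` evaluates to a value that belongs to `X` with the credit that remains of `c` after
the cost of the evaluation has been paid. -/
def EvalsIn (X : Cand) (t : Term) (c : ℕ) : Prop :=
  ∃ v m k, Cost t m v ∧ (v, k) ∈ X ∧ m + k ≤ c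

section

variable {X Y : Cand} {t u v : Term} {c d m : ℕ}

theorem EvalsIn.mono (h : EvalsIn X t c) (hXY : X ≤ Y) (hcd : c ≤ d) : EvalsIn Y t d :=
  let ⟨v, m, k, hv, hk, hc⟩ := h
  ⟨v, m, k, hv, hXY hk, hc.trans hcd⟩

theorem EvalsIn.of_mem (h : (v, c) ∈ X) : EvalsIn X v c :=
  ⟨v, 0, c, .refl v, h, (zero_add c).le⟩

theorem EvalsIn.expand (h : EvalsIn X u c) (ht : Cost t m u) : EvalsIn X t (m + c) :=
  let ⟨v, m', k, hv, hk, hc⟩ := h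
  ⟨v, m + m', k, ht.trans hv, hk, by omega⟩

theorem EvalsIn.exists_hasTime (h : EvalsIn X t c) : ∃ n ≤ c, t.HasTime n :=
  let ⟨v, m, _, hv, hk, hc⟩ := h
  ⟨m, by omega, v, Cand.isValue hk, hv⟩

-- All these evaluations produce the same value at the same cost.
theorem EvalsIn.iInf {ι : Type} [Nonempty ι] {F : ι → Cand} (h : ∀ i, EvalsIn (F i) t c) :
    EvalsIn (⨅ i, F i) t c := by
  obtain ⟨i⟩ := ‹Nonempty ι›
  obtain ⟨v, m, k, hv, hk, hc⟩ := h i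
  refine ⟨v, m, c - m, hv, Cand.mem_iInf.2 fun j => ?_, by omega⟩
  obtain ⟨v', m', k', hv', hk', hc'⟩ := h j
  obtain ⟨rfl, rfl⟩ := hv.unique (Cand.isValue hk) hv' (Cand.isValue hk')
  exact Cand.mono hk' (by omega)

end

namespace Cand

/-- The values that map members of `X` to members of `Y`, adding up the credits. -/
def lolli (X Y : Cand) : Cand where
  carrier := {a | IsValue a.1 ∧ LC 0 a.1 ∧
    ∀ u q, (u, q) ∈ X → EvalsIn Y (app a.1 u) (a.2 + q)}
  isValue' h := h.1
  lc' h := h.2.1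
  mono' h hcd := ⟨h.1, h.2.1,
    fun u q hu => (h.2.2 u q hu).mono le_rfl (Nat.add_le_add_right hcd q)⟩

/-- The values that map members of `X` of bounded size to members of `Y`, where `f` computes the
grade of the result and `n` is the value of the parameter. The credit of the argument is not
available in the result, as it pays for one copy only. -/
noncomputable def imp {R S : Type} (n : ℕ) (X : R → Cand) (Y : S → Cand) (f : Bound R → Grade S) :
    Cand where
  carrier := {a | IsValue a.1 ∧ LC 0 a.1 ∧
    ∀ u (e : Bound R), size u ≤ e.size.eval n → (u, e.credit.eval n) ∈ X e.res →
      EvalsIn (Y (f e).res) (app a.1 u) (a.2 + (f e).credit.eval n)}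
  isValue' h := h.1
  lc' h := h.2.1
  mono' h hcd := ⟨h.1, h.2.1,
    fun u e hs hu => (h.2.2 u e hs hu).mono le_rfl (Nat.add_le_add_right hcd _)⟩

/-- The action of an abstraction on resources, where `k` bounds the number of occurrences of the
bound variable and `g` is the action of its body: the β-step makes up to `k` copies. -/
noncomputable def absRes {R S : Type} (k : ℕ[X]) (g : Bound R → Grade S) (e : Bound R) : Grade S :=
  ⟨k * e.size + 1 + (g e).credit, (g e).res⟩

variable {R S : Type} {n c z : ℕ} {t : Term} {σ : ℕ → Term}

theorem lolli_mono {X X' Y Y' : Cand} (hX : X' ≤ X) (hY : Y ≤ Y') : lolli X Y ≤ lolli X' Y' :=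
  fun _ ha => ⟨ha.1, ha.2.1, fun u q hu => (ha.2.2 u q (hX hu)).mono hY le_rfl⟩

theorem imp_mono {X X' : R → Cand} {Y Y' : S → Cand} (hX : X' ≤ X) (hY : Y ≤ Y')
    (f : Bound R → Grade S) : imp n X Y f ≤ imp n X' Y' f :=
  fun _ ha => ⟨ha.1, ha.2.1, fun u e hs hu => (ha.2.2 u e hs (hX _ hu)).mono (hY _) le_rfl⟩

theorem bind_abs_mem_lolli {X Y : Cand} (ht : LC 0 t) (hσ : ∀ x, LC 0 (σ x)) (hocc : occ z t ≤ 1)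
    (h : ∀ v q, (v, q) ∈ X → EvalsIn Y (bind (Function.update σ z v) t) (c + q)) :
    (bind σ (abs z t), c + 1) ∈ lolli X Y := by
  refine ⟨.lam _, (ht.closeAt z).bind hσ, fun v q hv => ?_⟩
  obtain ⟨m, hm, hβ⟩ := cost_app_bind_abs z ht hσ (isValue hv)
  rw [Nat.sub_eq_zero_of_le hocc, Nat.zero_mul] at hm
  exact ((h v q hv).expand hβ).mono le_rfl (by dsimp; omega)

theorem bind_abs_mem_imp {X : R → Cand} {Y : S → Cand} {k : ℕ[X]} {g : Bound R → Grade S}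
    (ht : LC 0 t) (hσ : ∀ x, LC 0 (σ x)) (hocc : occ z t ≤ k.eval n)
    (h : ∀ v (e : Bound R), size v ≤ e.size.eval n → (v, e.credit.eval n) ∈ X e.res →
      EvalsIn (Y (g e).res) (bind (Function.update σ z v) t) (c + (g e).credit.eval n)) :
    (bind σ (abs z t), c) ∈ imp n X Y (absRes k g) := by
  refine ⟨.lam _, (ht.closeAt z).bind hσ, fun v e hsize hv => ?_⟩
  obtain ⟨m, hm, hβ⟩ := cost_app_bind_abs z ht hσ (isValue hv)
  have hcopies : (occ z t - 1) * size v ≤ k.eval n * e.size.eval n :=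
    Nat.mul_le_mul ((Nat.sub_le _ 1).trans hocc) hsize
  refine ((h v e hsize hv).expand hβ).mono le_rfl ?_
  simp only [absRes, Polynomial.eval_add, Polynomial.eval_mul, Polynomial.eval_one]
  omega

end Cand

section

variable {R S : Type} {n c d : ℕ} {t u : Term}

theorem EvalsIn.app_lolli {X Y : Cand} (ht : EvalsIn (.lolli X Y) t c)
    (hu : EvalsIn X u d) : EvalsIn Y (app t u) (c + d) := by
  obtain ⟨f, m, k, hf, hk, hc⟩ := ht
  obtain ⟨v, m', k', hv, hk', hd⟩ := hu
  exact ((hk.2.2 v k' hk').expand ((hf.appL u).trans (hv.appR f))).mono le_rfl (by dsimp; omega)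

theorem EvalsIn.app_imp {X : R → Cand} {Y : S → Cand} {f : Bound R → Grade S}
    {e : Bound R} (ht : EvalsIn (.imp n X Y f) t c)
    (hu : EvalsIn (X e.res) u (e.credit.eval n))
    (hsize : size u + e.credit.eval n ≤ e.size.eval n) :
    EvalsIn (Y (f e).res) (app t u) (c + e.credit.eval n + (f e).credit.eval n) := by
  obtain ⟨v₁, m₁, k₁, hv₁, hk₁, hc₁⟩ := ht
  obtain ⟨v₂, m₂, k₂, hv₂, hk₂, hc₂⟩ := hu
  have hv₂_size : size v₂ ≤ e.size.eval n := by have := hv₂.size_le; omega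
  have happ := hk₁.2.2 v₂ e hv₂_size (Cand.mono hk₂ (by omega))
  exact (happ.expand ((hv₁.appL u).trans (hv₂.appR v₁))).mono le_rfl (by dsimp; omega)

end

/-! ### Interpretation of formulas -/

/-- The valuation `η` extended to the scope of one more binder. -/
def scons (X : Cand) (η : ℕ → Cand) : ℕ → Cand
  | 0 => X
  | n + 1 => η n

/-- The values that realize `A` with the resource `r`, where `n` is the value of the parameter and
`η` a valuation of the propositional variables. The shape `s` is meant to be that of `A`; it is a
separate argument because renaming and instantiation preserve the shape of a formula only up to a
propositional equality. -/
noncomputable def interp (n : ℕ) : Formula → (ℕ → Cand) → (s : Shape) → s.Res → Cand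
  | var k, η, _, _ => η k
  | all A, η, s, r => ⨅ X, interp n A (scons X η) s r
  | mu A, η, s, r => sInf {X | interp n A (scons X η) s r ≤ X}
  | lolli L B, η, s, r => .lolli (interp n L η .base .unit) (interp n B η s r)
  | imp _ _, _, .base, _ => ⊤
  | imp A B, η, .arr s t, f => .imp n (interp n A η s) (interp n B η t) f

section

variable (n : ℕ) {A L : Formula} {b : Bool} {k : ℕ} {η η' : ℕ → Cand} {σ : ℕ → Formula}

theorem scons_comp_upRen (X : Cand) (η : ℕ → Cand) (ρ : ℕ → ℕ) :
    scons X η ∘ upRen ρ = scons X (η ∘ ρ) := by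
  funext k
  cases k <;> rfl

theorem interp_ren (ρ : ℕ → ℕ) (A : Formula) (η : ℕ → Cand) (s : Shape) (r : s.Res) :
    interp n (ren ρ A) η s r = interp n A (η ∘ ρ) s r := by
  induction A generalizing ρ η s with
  | var k => rfl
  | all A ih => simp only [ren, interp, ih, scons_comp_upRen]
  | mu A ih => simp only [ren, interp, ih, scons_comp_upRen]
  | lolli L B ihL ihB => simp only [ren, interp, ihL, ihB]
  | imp A B ihA ihB =>
    cases s with
    | base => rfl
    | arr s t => simp only [ren, interp, funext (ihA ρ η s), funext (ihB ρ η t)]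

theorem interp_shift (A : Formula) (X : Cand) (η : ℕ → Cand) (s : Shape) (r : s.Res) :
    interp n A.shift (scons X η) s r = interp n A η s r :=
  interp_ren n Nat.succ A (scons X η) s r

theorem Formula.IsLinear.interp_eq (h : IsLinear L) (η : ℕ → Cand) (s : Shape) (r : s.Res) :
    interp n L η s r = interp n L η .base .unit := by
  induction h generalizing η with
  | var k => rfl
  | all _ ih => simp only [interp, ih]
  | mu _ _ ih => simp only [interp, ih]
  | lolli _ _ _ ih => simp only [interp, ih]

theorem interp_upSubst (σ : ℕ → Formula) (X : Cand) (η : ℕ → Cand) :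
    (fun k => interp n (upSubst σ k) (scons X η) .base .unit) =
      scons X fun k => interp n (σ k) η .base .unit := by
  funext k
  cases k with
  | zero => rfl
  | succ k => exact interp_shift n _ X η _ _

theorem interp_subst (h : ∀ k, IsLinear (σ k)) (A : Formula) (η : ℕ → Cand) (s : Shape)
    (r : s.Res) :
    interp n (subst σ A) η s r = interp n A (fun k => interp n (σ k) η .base .unit) s r := by
  induction A generalizing σ η s with
  | var k => exact (h k).interp_eq n η s r
  | all A ih => simp only [subst, interp, ih (isLinear_upSubst h), interp_upSubst]
  | mu A ih => simp only [subst, interp, ih (isLinear_upSubst h), interp_upSubst]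
  | lolli L B ihL ihB => simp only [subst, interp, ihL h, ihB h]
  | imp A B ihA ihB =>
    cases s with
    | base => rfl
    | arr s t => simp only [subst, interp, funext (ihA h η s), funext (ihB h η t)]

theorem interp_inst (hL : IsLinear L) (A : Formula) (η : ℕ → Cand) (s : Shape) (r : s.Res) :
    interp n (inst A L) η s r = interp n A (scons (interp n L η .base .unit) η) s r := by
  rw [inst, interp_subst n (isLinear_instSubst hL)]
  congr 1
  funext k
  cases k <;> rfl

/-- The valuations differ at most at `k`, where they increase if `b` is `true` and decrease if `b`
is `false`. -/
structure VariesAt (b : Bool) (k : ℕ) (η η' : ℕ → Cand) : Prop where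
  eq_of_ne {m : ℕ} : m ≠ k → η m = η' m
  le : b = true → η k ≤ η' k
  ge : b = false → η' k ≤ η k

theorem VariesAt.symm (h : VariesAt b k η η') : VariesAt (!b) k η' η where
  eq_of_ne hm := (h.eq_of_ne hm).symm
  le hb := h.ge (by simpa using hb)
  ge hb := h.le (by simpa using hb)

theorem VariesAt.scons (h : VariesAt b k η η') (X : Cand) :
    VariesAt b (k + 1) (scons X η) (scons X η') where
  eq_of_ne {m} hm := by
    cases m with
    | zero => rfl
    | succ m => exact h.eq_of_ne (by omega)
  le := h.le
  ge := h.ge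

theorem Formula.OccursOnly.interp_le (hA : OccursOnly b k A) (h : VariesAt b k η η') (s : Shape)
    (r : s.Res) : interp n A η s r ≤ interp n A η' s r := by
  induction A generalizing b k η η' s with
  | var m =>
    rcases eq_or_ne m k with rfl | hm
    · cases b
      · exact absurd rfl hA
      · exact h.le rfl
    · exact (h.eq_of_ne hm).le
  | all A ih =>
    simp only [OccursOnly] at hA
    exact iInf_mono fun X => ih hA (h.scons X) s r
  | mu A ih =>
    simp only [OccursOnly] at hA
    exact sInf_le_sInf fun X hX => (ih hA (h.scons X) s r).trans hX
  | lolli L B ihL ihB =>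
    simp only [OccursOnly] at hA
    exact Cand.lolli_mono (ihL hA.1 h.symm .base .unit) (ihB hA.2 h s r)
  | imp A B ihA ihB =>
    simp only [OccursOnly] at hA
    cases s with
    | base => exact le_rfl
    | arr s t => exact Cand.imp_mono (ihA hA.1 h.symm s) (ihB hA.2 h t) r

theorem interp_scons_interp_mu (h : OccursOnly true 0 A) (η : ℕ → Cand) (s : Shape) (r : s.Res) :
    interp n A (scons (interp n (mu A) η s r) η) s r = interp n (mu A) η s r :=
  OrderHom.map_lfp
    { toFun := fun X => interp n A (scons X η) s r
      monotone' := fun X Y hXY => h.interp_le n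
        { eq_of_ne := fun {m} hm => by
            cases m with
            | zero => exact absurd rfl hm
            | succ m => rfl
          le := fun _ => hXY
          ge := nofun } s r }

theorem interp_inst_mu (hL : IsLinear (mu L)) (η : ℕ → Cand) (s s' : Shape) (r : s.Res)
    (r' : s'.Res) : interp n (inst L (mu L)) η s r = interp n (mu L) η s' r' := by
  obtain ⟨hL', hpos⟩ := isLinear_mu.1 hL
  rw [interp_inst n hL, hL'.interp_eq, interp_scons_interp_mu n hpos, hL.interp_eq n η s' r']

end

/-! ### Soundness of the typing rules -/

/-- What is known about the intuitionistic variables. The bounds are indexed by the shape of the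
formula that a context assigns to the variable. -/
abbrev Env : Type := (x : ℕ) → (s : Shape) → Bound s.Res

/-- The environment `γ`, changed at the variable `z` and the shape `s`. -/
def Env.update (γ : Env) (z : ℕ) (s : Shape) (e : Bound s.Res) : Env :=
  Function.update γ z (Function.update (γ z) s e)

/-- A bound for the sizes of the realizers of an intuitionistic context. -/
noncomputable def Env.sizeSum (γ : Env) (Γ : Ctx) : ℕ[X] :=
  (Γ.map fun a => (γ a.1 a.2.shape).size).sum

/-- The sum of the credits of the realizers of a linear context. -/
def credit (d : ℕ → ℕ) (Δ : Ctx) : ℕ := (Δ.map fun a => d a.1).sum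

/-- The substitution `σ` maps the variables of `Γ` and `Δ` to realizers of their formulas, as
described by `γ` for `Γ` and with the credits `d` for `Δ`. -/
structure Realizes (n : ℕ) (η : ℕ → Cand) (Γ Δ : Ctx) (γ : Env) (σ : ℕ → Term) (d : ℕ → ℕ) :
    Prop where
  lc (x : ℕ) : LC 0 (σ x)
  size_le : ∀ a ∈ Γ, size (σ a.1) ≤ (γ a.1 a.2.shape).size.eval n
  mem_int : ∀ a ∈ Γ, (σ a.1, (γ a.1 a.2.shape).credit.eval n) ∈
    interp n a.2 η a.2.shape (γ a.1 a.2.shape).res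
  mem_lin : ∀ a ∈ Δ, (σ a.1, d a.1) ∈ interp n a.2 η .base .unit

/-- Semantic typing: every instance of `t` by realizers of the contexts evaluates to a realizer of
`B` of shape `s`, and the grade of that realizer is computed from the environment alone. -/
def Sound (Γ Δ : Ctx) (t : Term) (B : Formula) (s : Shape) : Prop :=
  ∃ g : Env → Grade s.Res, ∀ n η γ σ d, Realizes n η Γ Δ γ σ d →
    EvalsIn (interp n B η s (g γ).res) (bind σ t) ((g γ).credit.eval n + credit d Δ)

section

variable {d d' : ℕ → ℕ} {Δ : Ctx}

@[simp]
theorem credit_zero (d : ℕ → ℕ) : credit d 0 = 0 := rfl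

@[simp]
theorem credit_cons (d : ℕ → ℕ) (a : ℕ × Formula) (Δ : Ctx) :
    credit d (a ::ₘ Δ) = d a.1 + credit d Δ := by
  simp only [credit, Multiset.map_cons, Multiset.sum_cons]

@[simp]
theorem credit_add (d : ℕ → ℕ) (Δ Δ' : Ctx) : credit d (Δ + Δ') = credit d Δ + credit d Δ' := by
  simp only [credit, Multiset.map_add, Multiset.sum_add]

@[simp]
theorem credit_shift (d : ℕ → ℕ) (Δ : Ctx) : credit d Δ.shift = credit d Δ :=
  congrArg Multiset.sum (Multiset.map_map _ _ _)

theorem credit_congr (h : ∀ x ∈ Δ.dom, d x = d' x) : credit d Δ = credit d' Δ :=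
  congrArg Multiset.sum (Multiset.map_congr rfl fun _ ha => h _ (Ctx.mem_dom_of_mem ha))

theorem credit_update {z : ℕ} (hz : z ∉ Δ.dom) (d : ℕ → ℕ) (q : ℕ) :
    credit (Function.update d z q) Δ = credit d Δ :=
  credit_congr fun _ hx => Function.update_of_ne (ne_of_mem_of_not_mem hx hz) _ _

end

namespace Realizes

variable {n : ℕ} {η : ℕ → Cand} {Γ Γ' Δ Δ' : Ctx} {γ : Env} {σ : ℕ → Term} {d : ℕ → ℕ}
  {A L : Formula} {v : Term} {z : ℕ}

theorem zero (n : ℕ) (η : ℕ → Cand) (γ : Env) (d : ℕ → ℕ) : Realizes n η 0 0 γ fvar d where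
  lc _ := trivial
  size_le _ ha := absurd ha (Multiset.notMem_zero _)
  mem_int _ ha := absurd ha (Multiset.notMem_zero _)
  mem_lin _ ha := absurd ha (Multiset.notMem_zero _)

theorem comap (h : Realizes n η Γ Δ γ σ d) (ρ : ℕ → ℕ) (hΓ : ∀ a ∈ Γ', (ρ a.1, a.2) ∈ Γ)
    (hΔ : ∀ a ∈ Δ', (ρ a.1, a.2) ∈ Δ) : Realizes n η Γ' Δ' (γ ∘ ρ) (σ ∘ ρ) (d ∘ ρ) where
  lc x := h.lc (ρ x)
  size_le a ha := h.size_le _ (hΓ a ha)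
  mem_int a ha := h.mem_int _ (hΓ a ha)
  mem_lin a ha := h.mem_lin _ (hΔ a ha)

theorem mono (h : Realizes n η Γ Δ γ σ d) (hΓ : Γ' ≤ Γ) (hΔ : Δ' ≤ Δ) :
    Realizes n η Γ' Δ' γ σ d :=
  h.comap id (fun _ ha => Multiset.mem_of_le hΓ ha) fun _ ha => Multiset.mem_of_le hΔ ha

theorem shift (h : Realizes n η Γ Δ γ σ d) (X : Cand) :
    Realizes n (scons X η) Γ.shift Δ.shift γ σ d where
  lc := h.lc
  size_le := Ctx.forall_mem_shift.2 fun a ha => by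
    rw [shape_shift]
    exact h.size_le a ha
  mem_int := Ctx.forall_mem_shift.2 fun a ha => by
    rw [interp_shift, shape_shift]
    exact h.mem_int a ha
  mem_lin := Ctx.forall_mem_shift.2 fun a ha => by
    rw [interp_shift]
    exact h.mem_lin a ha

theorem update_int (h : Realizes n η Γ Δ γ σ d) (hz : z ∉ Γ.dom + Δ.dom) {e : Bound A.shape.Res}
    (hsize : size v ≤ e.size.eval n)
    (hv : (v, e.credit.eval n) ∈ interp n A η A.shape e.res) :
    Realizes n η ((z, A) ::ₘ Γ) Δ (γ.update z A.shape e) (Function.update σ z v) d := by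
  rw [← Ctx.dom_add] at hz
  have hne : ∀ a ∈ Γ + Δ, a.1 ≠ z := fun a ha =>
    ne_of_mem_of_not_mem (Ctx.mem_dom_of_mem ha) hz
  simp only [Multiset.mem_add, or_imp, forall_and] at hne
  refine ⟨lc_update h.lc z (Cand.lc hv), Multiset.forall_mem_cons.2 ⟨?_, fun a ha => ?_⟩,
    Multiset.forall_mem_cons.2 ⟨?_, fun a ha => ?_⟩, fun a ha => ?_⟩
  · simpa [Env.update] using hsize
  · simpa [Env.update, hne.1 a ha] using h.size_le a ha
  · simpa [Env.update] using hv
  · simpa [Env.update, hne.1 a ha] using h.mem_int a ha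
  · simpa [hne.2 a ha] using h.mem_lin a ha

theorem update_lin (h : Realizes n η Γ Δ γ σ d) (hz : z ∉ Γ.dom + Δ.dom) {q : ℕ}
    (hv : (v, q) ∈ interp n L η .base .unit) :
    Realizes n η Γ ((z, L) ::ₘ Δ) γ (Function.update σ z v) (Function.update d z q) := by
  rw [← Ctx.dom_add] at hz
  have hne : ∀ a ∈ Γ + Δ, a.1 ≠ z := fun a ha =>
    ne_of_mem_of_not_mem (Ctx.mem_dom_of_mem ha) hz
  simp only [Multiset.mem_add, or_imp, forall_and] at hne
  refine ⟨lc_update h.lc z (Cand.lc hv), fun a ha => ?_, fun a ha => ?_,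
    Multiset.forall_mem_cons.2 ⟨?_, fun a ha => ?_⟩⟩
  · simpa [hne.1 a ha] using h.size_le a ha
  · simpa [hne.1 a ha] using h.mem_int a ha
  · simpa using hv
  · simpa [hne.2 a ha] using h.mem_lin a ha

theorem size_bind_le (h : Realizes n η Γ Δ γ σ d) {u : Term}
    (hu : ∀ x ∉ Γ.dom, occ x u = 0) :
    size (bind σ u) ≤ size u * (1 + (γ.sizeSum Γ).eval n) := by
  refine Term.size_bind_le fun x hx => ?_
  obtain ⟨a, ha, rfl⟩ := Multiset.mem_map.1 (not_imp_comm.1 (hu x) hx)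
  rw [Env.sizeSum, Polynomial.eval_multisetSum, Multiset.map_map]
  exact (h.size_le a ha).trans
    (Multiset.single_le_sum (fun _ _ => Nat.zero_le _) _ (Multiset.mem_map_of_mem _ ha))

end Realizes

namespace Sound

variable {Γ Γ₁ Γ₂ Δ Δ₁ Δ₂ : Ctx} {t u : Term} {A B L : Formula} {s s' : Shape} {x y z : ℕ}

theorem ax1 (x : ℕ) (A : Formula) : Sound {(x, A)} 0 (fvar x) A A.shape := by
  refine ⟨fun γ => (γ x A.shape).toGrade, fun n η γ σ d h => ?_⟩
  exact .of_mem (h.mem_int _ (Multiset.mem_singleton_self _))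

theorem ax2 (x : ℕ) (hL : IsLinear L) (s : Shape) : Sound 0 {(x, L)} (fvar x) L s := by
  refine ⟨fun _ => ⟨0, Classical.ofNonempty⟩, fun n η γ σ d h => ?_⟩
  have hx := h.mem_lin _ (Multiset.mem_singleton_self _)
  rw [hL.interp_eq]
  exact (EvalsIn.of_mem hx).mono le_rfl (by simp [credit])

theorem of_interp_eq (h : Sound Γ Δ t A s)
    (hAB : ∀ n η r r', interp n A η s r = interp n B η s' r') : Sound Γ Δ t B s' := by
  obtain ⟨g, h⟩ := h
  refine ⟨fun γ => ⟨(g γ).credit, Classical.ofNonempty⟩, fun n η γ σ d hσ => ?_⟩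
  exact hAB n η (g γ).res _ ▸ h n η γ σ d hσ

theorem muE (hL : IsLinear (mu L)) (h : Sound Γ Δ t (mu L) s) :
    Sound Γ Δ t (inst L (mu L)) s' :=
  h.of_interp_eq fun n η _ _ => (interp_inst_mu n hL η _ _ _ _).symm

theorem muI (hL : IsLinear (mu L)) (h : Sound Γ Δ t (inst L (mu L)) s) :
    Sound Γ Δ t (mu L) s' :=
  h.of_interp_eq fun n η _ _ => interp_inst_mu n hL η _ _ _ _

theorem allI (h : Sound Γ.shift Δ.shift t A s) : Sound Γ Δ t (all A) s := by
  obtain ⟨g, h⟩ := h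
  refine ⟨g, fun n η γ σ d hσ => EvalsIn.iInf fun X => ?_⟩
  simpa only [credit_shift] using h n _ γ σ d (hσ.shift X)

theorem allE (hL : IsLinear L) (h : Sound Γ Δ t (all A) s) : Sound Γ Δ t (inst A L) s := by
  obtain ⟨g, h⟩ := h
  refine ⟨g, fun n η γ σ d hσ => (h n η γ σ d hσ).mono ?_ le_rfl⟩
  rw [interp_inst n hL]
  exact iInf_le _ _

theorem impE (hu : ∀ x ∉ Γ₂.dom, occ x u = 0) (h₁ : Sound Γ₁ Δ t (imp A B) (.arr s s'))
    (h₂ : Sound Γ₂ 0 u A s) : Sound (Γ₁ + Γ₂) Δ (app t u) B s' := by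
  obtain ⟨f, h₁⟩ := h₁
  obtain ⟨g, h₂⟩ := h₂
  let e : Env → Bound s.Res := fun γ =>
    { g γ with size := size u * (1 + γ.sizeSum Γ₂) + (g γ).credit }
  refine ⟨fun γ => ⟨(f γ).credit + (g γ).credit + ((f γ).res (e γ)).credit,
    ((f γ).res (e γ)).res⟩, fun n η γ σ d hσ => ?_⟩
  have hσ₁ := hσ.mono (Multiset.le_add_right Γ₁ Γ₂) le_rfl
  have hσ₂ := hσ.mono (Multiset.le_add_left Γ₂ Γ₁) (Multiset.zero_le Δ)
  have hsize : size (bind σ u) + (e γ).credit.eval n ≤ (e γ).size.eval n := by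
    simpa [e] using hσ₂.size_bind_le hu
  have happ := (h₁ n η γ σ d hσ₁).app_imp (e := e γ) (h₂ n η γ σ d hσ₂) hsize
  refine happ.mono le_rfl ?_
  simp only [e, Polynomial.eval_add]
  omega

theorem impI (hz : z ∉ Γ.dom + Δ.dom) (ht : LC 0 t) (h : Sound ((z, A) ::ₘ Γ) Δ t B s) :
    Sound Γ Δ (abs z t) (imp A B) (.arr A.shape s) := by
  obtain ⟨g, h⟩ := h
  refine ⟨fun γ => ⟨0, Cand.absRes (size t : ℕ[X]) fun e => g (γ.update z A.shape e)⟩,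
    fun n η γ σ d hσ => ?_⟩
  have hocc : occ z t ≤ (size t : ℕ[X]).eval n := by simpa using occ_le_size z t
  refine (EvalsIn.of_mem (Cand.bind_abs_mem_imp (c := credit d Δ) ht hσ.lc hocc
    fun v e hsize hv => ?_)).mono le_rfl (Nat.le_add_left _ _)
  rw [add_comm]
  exact h n η _ _ d (hσ.update_int hz hsize hv)

theorem lolliE (hL : IsLinear L) (h₁ : Sound Γ₁ Δ₁ t (lolli L B) s) (h₂ : Sound Γ₂ Δ₂ u L s') :
    Sound (Γ₁ + Γ₂) (Δ₁ + Δ₂) (app t u) B s := by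
  obtain ⟨f, h₁⟩ := h₁
  obtain ⟨g, h₂⟩ := h₂
  refine ⟨fun γ => ⟨(f γ).credit + (g γ).credit, (f γ).res⟩, fun n η γ σ d hσ => ?_⟩
  have ht := h₁ n η γ σ d (hσ.mono (Multiset.le_add_right _ _) (Multiset.le_add_right _ _))
  have hu := h₂ n η γ σ d (hσ.mono (Multiset.le_add_left _ _) (Multiset.le_add_left _ _))
  rw [hL.interp_eq] at hu
  refine (ht.app_lolli hu).mono le_rfl ?_
  simp only [credit_add, Polynomial.eval_add]
  omega

theorem lolliI (hz : z ∉ Γ.dom + Δ.dom) (ht : LC 0 t) (hocc : occ z t ≤ 1)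
    (h : Sound Γ ((z, L) ::ₘ Δ) t B s) : Sound Γ Δ (abs z t) (lolli L B) s := by
  obtain ⟨g, h⟩ := h
  have hzΔ : z ∉ Δ.dom := fun h => hz (Multiset.mem_add.2 (.inr h))
  refine ⟨fun γ => ⟨(g γ).credit + 1, (g γ).res⟩, fun n η γ σ d hσ => ?_⟩
  refine (EvalsIn.of_mem (Cand.bind_abs_mem_lolli (c := (g γ).credit.eval n + credit d Δ) ht
    hσ.lc hocc fun v q hv => ?_)).mono le_rfl ?_
  · refine (h n η γ _ _ (hσ.update_lin hz hv)).mono le_rfl ?_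
    simp only [credit_cons, credit_update hzΔ, Function.update_self]
    omega
  · simp only [Polynomial.eval_add, Polynomial.eval_one]
    omega

theorem contr (hx : x ∉ Γ.dom + Δ.dom) (hy : y ∉ Γ.dom + Δ.dom)
    (h : Sound ((x, A) ::ₘ (y, A) ::ₘ Γ) Δ t B s) :
    Sound ((z, A) ::ₘ Γ) Δ (rename y z (rename x z t)) B s := by
  obtain ⟨g, h⟩ := h
  let ρ : ℕ → ℕ := Function.update id y z ∘ Function.update id x z
  have hρx : ρ x = z := by by_cases hzy : z = y <;> simp [ρ, hzy]
  have hρy : ρ y = z := by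
    by_cases hyx : y = x
    · rw [hyx, hρx]
    · simp [ρ, hyx]
  have hρ : ∀ w ∈ Γ.dom + Δ.dom, ρ w = w := fun w hw => by
    simp [ρ, ne_of_mem_of_not_mem hw hx, ne_of_mem_of_not_mem hw hy]
  have hρΓ : ∀ a ∈ (x, A) ::ₘ (y, A) ::ₘ Γ, (ρ a.1, a.2) ∈ (z, A) ::ₘ Γ := by
    simp only [Multiset.forall_mem_cons, hρx, hρy]
    refine ⟨Multiset.mem_cons_self _ _, Multiset.mem_cons_self _ _, fun a ha => ?_⟩
    rw [hρ _ (Multiset.mem_add.2 (.inl (Ctx.mem_dom_of_mem ha)))]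
    exact Multiset.mem_cons_of_mem ha
  have hρΔ : ∀ w ∈ Δ.dom, ρ w = w := fun w hw => hρ w (Multiset.mem_add.2 (.inr hw))
  refine ⟨fun γ => g (γ ∘ ρ), fun n η γ σ d hσ => ?_⟩
  rw [bind_rename, bind_rename, credit_congr (d' := d ∘ ρ) fun w hw => by simp [hρΔ w hw]]
  refine h n η _ _ _ (hσ.comap ρ hρΓ fun a ha => ?_)
  rwa [hρΔ _ (Ctx.mem_dom_of_mem ha)]

theorem derel (hL : IsLinear L) (hx : x ∉ Γ.dom + Δ.dom) (h : Sound Γ ((x, L) ::ₘ Δ) t B s) :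
    Sound ((x, L) ::ₘ Γ) Δ t B s := by
  obtain ⟨g, h⟩ := h
  have hxΔ : x ∉ Δ.dom := fun h => hx (Multiset.mem_add.2 (.inr h))
  refine ⟨fun γ => ⟨(g γ).credit + (γ x L.shape).credit, (g γ).res⟩, fun n η γ σ d hσ => ?_⟩
  have hσx := hσ.mem_int _ (Multiset.mem_cons_self _ _)
  rw [hL.interp_eq] at hσx
  have hσ' := (hσ.mono (Multiset.le_cons_self _ _) le_rfl).update_lin hx hσx
  rw [Function.update_eq_self] at hσ'
  refine (h n η γ σ _ hσ').mono le_rfl ?_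
  simp only [credit_cons, credit_update hxΔ, Function.update_self, Polynomial.eval_add]
  omega

theorem weak (h : Sound Γ₁ Δ₁ t B s) (Γ₂ Δ₂ : Ctx) : Sound (Γ₁ + Γ₂) (Δ₁ + Δ₂) t B s := by
  obtain ⟨g, h⟩ := h
  refine ⟨g, fun n η γ σ d hσ => ?_⟩
  have ht := h n η γ σ d (hσ.mono (Multiset.le_add_right _ _) (Multiset.le_add_right _ _))
  refine ht.mono le_rfl ?_
  rw [credit_add]
  omega

end Sound

theorem Typed.sound {Γ Δ : Ctx} {t : Term} {A : Formula} (h : Typed Γ Δ t A) :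
    Sound Γ Δ t A A.shape := by
  induction h with
  | ax1 x => exact .ax1 x _
  | ax2 x hL => exact .ax2 x hL _
  | muE h ih => exact ih.muE (isFormula_mu.1 h.isFormula)
  | muI hL _ ih => exact ih.muI hL
  | allI _ ih => exact ih.allI
  | allE hL _ ih =>
    rw [shape_inst hL]
    exact ih.allE hL
  | impE _ _ h ih₁ ih₂ => exact ih₁.impE (fun x hx => h.occ_eq_zero (by simpa using hx)) ih₂
  | impI h ih => exact ih.impI h.notMem_of_cons_left h.lc
  | lolliE _ h _ ih₁ ih₂ => exact ih₁.lolliE (isFormula_lolli.1 h.isFormula).1 ih₂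
  | lolliI h ih => exact ih.lolliI h.notMem_of_cons_right h.lc (h.occ_le_one (by simp))
  | contr _ h ih =>
    have hnodup := h.nodup_dom
    simp only [Ctx.dom_cons, Multiset.cons_add, Multiset.nodup_cons] at hnodup
    exact ih.contr (fun hx => hnodup.1 (Multiset.mem_cons_of_mem hx)) hnodup.2.1
  | derel h ih =>
    exact ih.derel (h.isLinear_of_mem (Multiset.mem_cons_self _ _)) h.notMem_of_cons_right
  | weak _ _ _ _ ih => exact ih.weak _ _

/-! ### Church words -/

namespace Term

theorem size_closeAt (x k : ℕ) (t : Term) : size (closeAt x k t) = size t := by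
  induction t generalizing k with
  | bvar i => rfl
  | fvar y => simp only [closeAt]; split_ifs <;> rfl
  | lam t ih => exact congrArg (· + 1) (ih (k + 1))
  | app t s iht ihs => exact congrArg₂ (· + ·) (iht k) (ihs k)

theorem size_abs (x : ℕ) (t : Term) : size (abs x t) = size t + 1 :=
  congrArg (· + 1) (size_closeAt x 0 t)

theorem LC.abs {t : Term} (h : LC 0 t) (x : ℕ) : LC 0 (abs x t) :=
  h.closeAt x

section

variable (x₀ x₁ x : ℕ) (w : List Bool)

theorem size_churchBody_fvar :
    size (churchBody (fvar x₀) (fvar x₁) (fvar x) w) = w.length + 1 := by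
  induction w with
  | nil => rfl
  | cons b w ih => cases b <;> simp [churchBody, size, ih] <;> omega

theorem lc_churchBody_fvar : LC 0 (churchBody (fvar x₀) (fvar x₁) (fvar x) w) := by
  induction w with
  | nil => trivial
  | cons b w ih => cases b <;> exact ⟨trivial, ih⟩

theorem occ_churchBody_fvar_le {y : ℕ} (hy : x ≠ y) :
    occ y (churchBody (fvar x₀) (fvar x₁) (fvar x) w) ≤ w.length := by
  induction w with
  | nil => simp [churchBody, occ, hy]
  | cons b w ih =>
    have hhead : occ y (if b then fvar x₁ else fvar x₀) ≤ 1 := by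
      cases b <;> exact occ_le_size y (fvar _)
    simp only [churchBody, occ, List.length_cons]
    omega

theorem occ_churchBody_fvar_self (h₀ : x₀ ≠ x) (h₁ : x₁ ≠ x) :
    occ x (churchBody (fvar x₀) (fvar x₁) (fvar x) w) = 1 := by
  induction w with
  | nil => exact if_pos rfl
  | cons b w ih => cases b <;> simp [churchBody, occ, ih, h₀, h₁]

theorem bind_churchBody (σ : ℕ → Term) (f₀ f₁ t : Term) :
    bind σ (churchBody f₀ f₁ t w) = churchBody (bind σ f₀) (bind σ f₁) (bind σ t) w := by
  induction w with
  | nil => rfl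
  | cons b w ih => cases b <;> simp [churchBody, bind, ih]

theorem size_churchWord : size (churchWord w) = w.length + 4 := by
  simp only [churchWord, size_abs, size_churchBody_fvar]

end

end Term

theorem EvalsIn.churchBody {X : Cand} {f₀ f₁ v : Term} {q₀ q₁ q : ℕ}
    (h₀ : (f₀, q₀) ∈ X.lolli X) (h₁ : (f₁, q₁) ∈ X.lolli X) (hv : (v, q) ∈ X) (w : List Bool) :
    EvalsIn X (churchBody f₀ f₁ v w) (w.length * (q₀ + q₁) + q) := by
  induction w with
  | nil => exact (EvalsIn.of_mem hv).mono le_rfl (Nat.le_add_left _ _)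
  | cons b w ih =>
    have hf : EvalsIn (X.lolli X) (if b then f₁ else f₀) (q₀ + q₁) := by
      cases b
      · exact (EvalsIn.of_mem h₀).mono le_rfl (Nat.le_add_right _ _)
      · exact (EvalsIn.of_mem h₁).mono le_rfl (Nat.le_add_left _ _)
    refine (hf.app_lolli ih).mono le_rfl ?_
    rw [List.length_cons, add_one_mul]
    omega

/-- The resource of the Church words, where the value of the parameter is the length `n` of the
word: each of the two functions is copied at most `n` times, and the `n` calls are paid by the
credits of the functions. -/
noncomputable def churchRes : churchW.shape.Res :=
  Cand.absRes .X fun e₀ => ⟨0, Cand.absRes .X fun e₁ =>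
    ⟨.X * (e₀.credit + e₁.credit) + 1, Shape.Res.unit⟩⟩

theorem churchWord_mem_interp (w : List Bool) (η : ℕ → Cand) :
    (churchWord w, 0) ∈ interp w.length churchW η churchW.shape churchRes := by
  refine Cand.mem_iInf.2 fun X => ?_
  have hbody := lc_churchBody_fvar 0 1 2 w
  have hocc {y : ℕ} (hy : 2 ≠ y) := occ_churchBody_fvar_le 0 1 2 w hy
  rw [← bind_fvar (churchWord w)]
  have hfvar (x : ℕ) : LC 0 (fvar x) := trivial
  refine Cand.bind_abs_mem_imp ((hbody.abs 2).abs 1) hfvar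
    (by simpa [occ_abs] using hocc (y := 0) (by decide)) fun f₀ e₀ _ hf₀ => .of_mem ?_
  have hσ₀ := lc_update hfvar 0 (Cand.lc hf₀)
  simp only [Polynomial.eval_zero]
  refine Cand.bind_abs_mem_imp (hbody.abs 2) hσ₀
    (by simpa [occ_abs] using hocc (y := 1) (by decide)) fun f₁ e₁ _ hf₁ => .of_mem ?_
  have hσ₁ := lc_update hσ₀ 1 (Cand.lc hf₁)
  simp only [zero_add, Polynomial.eval_add, Polynomial.eval_mul, Polynomial.eval_X,
    Polynomial.eval_one]
  refine Cand.bind_abs_mem_lolli hbody hσ₁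
    (occ_churchBody_fvar_self 0 1 2 w (by decide) (by decide)).le fun v q hv => ?_
  rw [bind_churchBody]
  exact .churchBody hf₀ hf₁ hv w

end DIAL

theorem theorem4_general (A : DIAL.Formula) (t : DIAL.Term)
    (ht : DIAL.Typed 0 0 t (DIAL.Formula.imp DIAL.Formula.churchW A)) :
    ∃ P : Polynomial ℕ, ∀ w : List Bool,
      (∃ n : ℕ, (DIAL.Term.app t (DIAL.Term.churchWord w)).HasTime n) ∧
      ∀ n : ℕ, (DIAL.Term.app t (DIAL.Term.churchWord w)).HasTime n → n ≤ P.eval w.length := by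
  obtain ⟨g, hg⟩ := ht.sound
  let γ : DIAL.Env := fun _ _ => ⟨⟨0, Classical.ofNonempty⟩, 0⟩
  let e : DIAL.Bound DIAL.Formula.churchW.shape.Res := ⟨⟨0, DIAL.churchRes⟩, .X + 4⟩
  refine ⟨(g γ).credit + ((g γ).res e).credit, fun w => ?_⟩
  have htime : ∃ n ≤ ((g γ).credit + ((g γ).res e).credit).eval w.length,
      (DIAL.Term.app t (DIAL.Term.churchWord w)).HasTime n := by
    have hfun := hg w.length (fun _ => ⊤) γ DIAL.Term.fvar 0 (.zero _ _ _ _)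
    have harg := DIAL.EvalsIn.of_mem (DIAL.churchWord_mem_interp w fun _ => ⊤)
    rw [DIAL.Term.bind_fvar] at hfun
    have := (hfun.app_imp (e := e) (by simpa [e] using harg)
      (by simp [e, DIAL.Term.size_churchWord])).exists_hasTime
    simpa [e] using this
  obtain ⟨n, hn, hw⟩ := htime
  exact ⟨⟨n, hw⟩, fun m hm => (hm.unique hw).trans_le hn⟩

theorem theorem4 (L : DIAL.Formula) (hL : L.IsLinear) (t : DIAL.Term)
    (ht : DIAL.Typed 0 0 t (DIAL.Formula.imp DIAL.Formula.churchW L)) :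
    ∃ P : Polynomial ℕ, ∀ w : List Bool,
      (∃ n : ℕ, (DIAL.Term.app t (DIAL.Term.churchWord w)).HasTime n) ∧
      ∀ n : ℕ, (DIAL.Term.app t (DIAL.Term.churchWord w)).HasTime n → n ≤ P.eval w.length :=
  theorem4_general L t ht
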